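/- Let $d\ge 1$, $\Omega=[0,1]^d$, and let $f\in C^d(\Omega)$ with $\int_\Omega f\,dx=0$. Fix a fully connected network $v(\cdot;\theta)=T_L\circ\sigma\circ T_{L-1}\circ\cdots\circ\sigma\circ T_1:\mathbb R^d\to\mathbb R$ with affine maps $T_i(s)=A_is+B_i$ (fixed depth $L\ge 1$ and widths, scalar output) and activation $\sigma(x)=x/(1+e^{-x})$ applied coordinatewise; $\theta\in\mathbb R^D$ is the vector of all entries of the $A_i,B_i$. Let $\Theta=\{\theta\in\mathbb R^D:\|\theta\|_{\ell_\infty}\le B_\Theta\}$ with $B_\Theta>0$, and put $$\mathcal L_P(\theta)=\int_\Omega\Big(\tfrac12\|\nabla_x v(x;\theta)\|_{\ell_2}^2-f(x)v(x;\theta)\Big)dx+\tfrac12\Big(\int_\Omega v(x;\theta)\,dx\Big)^2 .$$ Let $K\subseteq\Theta$ be a nonempty closed convex set (for example $K=\Theta$). Let $L_0$ be a Lipschitz constant, in the $\ell_2$ norm, of $\nabla_\theta\mathcal L_P$ on $K$, and assume that $\mathcal L_P$ is strongly convex on $K$ with some constant $0<c<L_0$: $$\mathcal L_P(\bar\theta)\ge\mathcal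 L_P(\theta)+\nabla_\theta\mathcal L_P(\theta)^T(\bar\theta-\theta)+\tfrac c2\|\bar\theta-\theta\|_{\ell_2}^2\qquad(\theta,\bar\theta\in K).$$ Then $\mathcal L_P$ has a unique minimizer $\theta^*$ over $K$. Let $(P_j)_{j\ge1}$ be a sequence in $[0,1]^d$ with low-discrepancy blocks: there is a constant $C_0$ such that for all $n=2^\tau$, $\tau\in\mathbb N^+$, and all $k\ge0$, the star discrepancy $D_n^*$ (over the boxes $\prod_i[0,t_i)$, $t\in[0,1]^d$) of the block $X_{j,k}=P_{kn+j}$, $1\le j\le n$, is at most $C_0\,n^{-1}(\log n)^d$. Let $0<\alpha<2/L_0$. For $n=2^\tau$, $\tau\in\mathbb N^+$, consider gradient descent $$\theta_{k+1}=\theta_k-\alpha\,G_P(\theta_k,\xi_k),$$ $$G_P(\theta,\xi_k)=\nabla_\theta\Big\{\frac1n\sum_{j=1}^n\Big(\tfrac12\|\nabla_xv(X_{j,k};\theta)\|_{\ell_2}^2-f(X_{j,k})v(X_{j,k};\theta)\Big)+\tfrac12\Big(\frac1n\sum_{j=1}^nv(X_{j,k};\theta)\Big)^2\Big\}.$$ Then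 there is a constant $C$, independent of $n$ and of the initial point $\theta_0$, such that for every $n=2^\tau$, $\tau\in\mathbb N^+$, and every such sequence $(\theta_k)_{k\ge0}$ that stays in $K$, $$\limsup_{k\to\infty}\big(\mathcal L_P(\theta_k)-\mathcal L_P(\theta^*)\big)\le C\,n^{-1}(\log n)^d .$$ In particular, whenever the training error $\lim_{k\to\infty}\mathcal L_P(\theta_k)-\mathcal L_P(\theta^*)$ exists, it is $O\big(n^{-1}(\log n)^d\big)$. -/

import Mathlib

open Filter Topology MeasureTheory

noncomputable section

namespace DeepRitz

/-- The closed unit cube `Ω = [0,1]^d`, inside `ℝ^d` with its Euclidean norm. -/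
def unitCube (d : ℕ) : Set (EuclideanSpace ℝ (Fin d)) :=
  {x | ∀ i, x i ∈ Set.Icc (0 : ℝ) 1}

/-- The swish activation function `σ(x) = x / (1 + exp (-x))`. -/
def swish (x : ℝ) : ℝ := x / (1 + Real.exp (-x))

/-- Index set of all the weights of a fully connected network with input dimension `m`, hidden
layers of widths `ws` (from input to output) and scalar output; the depth (number of affine maps)
is `ws.length + 1`. A hidden layer `ℝ^m → ℝ^w` has the entries of a `w × m` matrix (`Fin w × Fin m`)
and of a bias vector (`Fin w`); the output layer `ℝ^m → ℝ` has a row (`Fin m`) and one bias. -/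
def WeightIndex : ℕ → List ℕ → Type
  | m, [] => Fin m ⊕ Unit
  | m, w :: ws => (Fin w × Fin m) ⊕ (Fin w ⊕ WeightIndex w ws)

instance instFintypeWeightIndex : (m : ℕ) → (ws : List ℕ) → Fintype (WeightIndex m ws)
  | m, [] => inferInstanceAs (Fintype (Fin m ⊕ Unit))
  | m, w :: ws =>
    letI := instFintypeWeightIndex w ws
    inferInstanceAs (Fintype ((Fin w × Fin m) ⊕ (Fin w ⊕ WeightIndex w ws)))

/-- The space `ℝ^D` of all weight vectors, with the `ℓ²` norm. -/
abbrev Weights (d : ℕ) (ws : List ℕ) : Type := EuclideanSpace ℝ (WeightIndex d ws)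

/-- The realization `T_L ∘ σ ∘ T_{L-1} ∘ ⋯ ∘ σ ∘ T_1`, with `σ` applied coordinatewise. -/
def evalNet : (m : ℕ) → (ws : List ℕ) → (WeightIndex m ws → ℝ) → (Fin m → ℝ) → ℝ
  | _, [], θ, x => (∑ j, θ (Sum.inl j) * x j) + θ (Sum.inr ())
  | _, w :: ws, θ, x =>
    evalNet w ws (fun p => θ (Sum.inr (Sum.inr p)))
      (fun i => swish ((∑ j, θ (Sum.inl (i, j)) * x j) + θ (Sum.inr (Sum.inl i))))

/-- The network function `v(x; θ)`. -/
def net {d : ℕ} {ws : List ℕ} (θ : Weights d ws) (x : EuclideanSpace ℝ (Fin d)) : ℝ :=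
  evalNet d ws (fun p => θ p) (fun i => x i)

/-- The parameter box `Θ = {θ : ‖θ‖_∞ ≤ B}`. -/
def paramBox (d : ℕ) (ws : List ℕ) (B : ℝ) : Set (Weights d ws) :=
  {θ | ∀ p, |θ p| ≤ B}

/-- The loss functional of the Poisson problem with Neumann boundary condition,
`∫_Ω (½ ‖∇u‖² - f u) dx + ½ (∫_Ω u dx)²`, for a smooth function `u`. -/
def poissonFunctional {d : ℕ} (f u : EuclideanSpace ℝ (Fin d) → ℝ) : ℝ :=
  (∫ x in unitCube d, (1 / 2 * ‖gradient u x‖ ^ 2 - f x * u x))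
    + 1 / 2 * (∫ x in unitCube d, u x) ^ 2

/-- The empirical loss functional at the sample points `X_1, …, X_n`. -/
def empiricalFunctional {d n : ℕ} (X : Fin n → EuclideanSpace ℝ (Fin d))
    (f u : EuclideanSpace ℝ (Fin d) → ℝ) : ℝ :=
  (1 / (n : ℝ)) * ∑ j, (1 / 2 * ‖gradient u (X j)‖ ^ 2 - f (X j) * u (X j))
    + 1 / 2 * ((1 / (n : ℝ)) * ∑ j, u (X j)) ^ 2

/-- The training loss `L_P(θ) = L_P(v(·; θ))`. -/
def poissonLoss {d : ℕ} {ws : List ℕ} (f : EuclideanSpace ℝ (Fin d) → ℝ)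
    (θ : Weights d ws) : ℝ :=
  poissonFunctional f (net θ)

/-- The gradient estimator `G_P(θ, ξ)`: the gradient in `θ` of the empirical loss. -/
def gradEstimator {d n : ℕ} {ws : List ℕ} (f : EuclideanSpace ℝ (Fin d) → ℝ)
    (X : Fin n → EuclideanSpace ℝ (Fin d)) (θ : Weights d ws) : Weights d ws :=
  gradient (fun ϑ : Weights d ws => empiricalFunctional X f (net ϑ)) θ

/-- The star discrepancy `D_n^*` of `n` points of the unit cube: the supremum, over the boxes
`[0, t)` with `t ∈ [0,1]^d`, of the difference between the proportion of points in the box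
and its volume. -/
def starDiscrepancy {d n : ℕ} (X : Fin n → EuclideanSpace ℝ (Fin d)) : ℝ :=
  ⨆ t : unitCube d,
    |((Finset.univ.filter fun j : Fin n => ∀ i, X j i < t.1 i).card : ℝ) / n - ∏ i, t.1 i|

/-- The `k`-th block of `n` successive points of a sequence (everything indexed from `0`). -/
def block {d : ℕ} (P : ℕ → EuclideanSpace ℝ (Fin d)) (n k : ℕ) :
    Fin n → EuclideanSpace ℝ (Fin d) :=
  fun j => P (k * n + j)

/-- A sequence in `[0,1]^d` whose successive blocks of `n = 2^τ` points, `τ ≥ 1`, have star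
discrepancy `O(n⁻¹ (log n)^d)`, uniformly over the blocks. -/
def HasLowDiscrepancyBlocks {d : ℕ} (P : ℕ → EuclideanSpace ℝ (Fin d)) : Prop :=
  (∀ j, P j ∈ unitCube d) ∧
    ∃ C : ℝ, ∀ τ : ℕ, 1 ≤ τ → ∀ n : ℕ, n = 2 ^ τ → ∀ k : ℕ,
      starDiscrepancy (block P n k) ≤ C * ((n : ℝ)⁻¹ * Real.log n ^ d)

/-- `θ_0, θ_1, …` are the iterates of gradient descent with constant stepsize `α` and mini-batch
size `n`, where step `k` uses the `k`-th block of `P` as its sample points. -/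
def IsDescent {d : ℕ} {ws : List ℕ} (f : EuclideanSpace ℝ (Fin d) → ℝ)
    (P : ℕ → EuclideanSpace ℝ (Fin d)) (α : ℝ) (n : ℕ) (θ : ℕ → Weights d ws) : Prop :=
  ∀ k, θ (k + 1) = θ k - α • gradEstimator f (block P n k) (θ k)

end DeepRitz

end

/-! Each step is a gradient step with a deterministic gradient error. If that error is at most `ε`
at every iterate, the descent lemma and the Polyak–Łojasiewicz inequality (a consequence of strong
convexity) contract the loss gap by a factor `q < 1`, up to an additive `O(ε ^ 2)`
(`exists_inexact_gradient_descent_le`). Hence the limsup of the gap is `O(ε ^ 2)`.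

The gradient error is a quadrature error: it is assembled from those of the θ-derivative of the
energy density, of the network and of its θ-derivative. All three are `C^d` in `(θ, x)`, so a
Koksma–Hlawka inequality with a constant uniform over the compact `K` gives `ε ≤ M *
starDiscrepancy` (`exists_norm_gradEstimator_sub_gradient_le`). With `r = n⁻¹ (log n)^d` the gap is
`O(r ^ 2)`, and `r ≤ d!` turns this into the stated `O(r)`.

Koksma–Hlawka is proved one coordinate at a time through `g(x_i) = g(1) - ∫₀¹ 1[x_i < s] ∂_i g(s)
ds`. Once all coordinates are treated, only box indicators times values of mixed partial derivatives
remain, and on these the quadrature error is controlled by the discrepancy. -/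

namespace DeepRitz

/-! ### Geometry of the unit cube and coordinate substitutions. -/

section Cube

variable {d : ℕ}

theorem unitCube_eq_preimage (d : ℕ) :
    unitCube d = WithLp.ofLp ⁻¹' (Set.univ.pi fun _ : Fin d => Set.Icc (0 : ℝ) 1) := by
  ext x
  simp only [unitCube, Set.mem_preimage, Set.mem_pi, Set.mem_univ, true_implies]
  rfl

theorem isCompact_unitCube (d : ℕ) : IsCompact (unitCube d) := by
  have h : IsCompact (Set.univ.pi fun _ : Fin d => Set.Icc (0 : ℝ) 1) :=
    isCompact_univ_pi fun _ => isCompact_Icc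
  have := h.image (PiLp.continuous_toLp 2 (fun _ : Fin d => ℝ))
  convert this using 1
  rw [unitCube_eq_preimage]
  ext x
  constructor
  · intro hx
    exact ⟨WithLp.ofLp x, hx, rfl⟩
  · rintro ⟨y, hy, rfl⟩
    exact hy

theorem measurableSet_unitCube (d : ℕ) : MeasurableSet (unitCube d) :=
  (isCompact_unitCube d).measurableSet

theorem convex_unitCube (d : ℕ) : Convex ℝ (unitCube d) := by
  intro x hx y hy a b ha hb hab i
  exact convex_Icc (0 : ℝ) 1 (hx i) (hy i) ha hb hab

/-- The data `f` is smooth only on the closed cube, so the mixed partials below are iterated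
`fderivWithin`, which need unique differentiability up to the boundary. -/
theorem uniqueDiffOn_unitCube (d : ℕ) : UniqueDiffOn ℝ (unitCube d) := by
  refine uniqueDiffOn_convex (convex_unitCube d) ⟨WithLp.toLp 2 fun _ => 1 / 2, ?_⟩
  rw [mem_interior]
  refine ⟨WithLp.ofLp ⁻¹' (Set.univ.pi fun _ : Fin d => Set.Ioo (0 : ℝ) 1), ?_, ?_, ?_⟩
  · intro x hx i
    exact Set.Ioo_subset_Icc_self (hx i (Set.mem_univ i))
  · exact (isOpen_set_pi Set.finite_univ fun _ _ => isOpen_Ioo).preimage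
      (PiLp.continuous_ofLp 2 (fun _ : Fin d => ℝ))
  · intro i _
    constructor <;> norm_num

theorem volume_real_box (s : Fin d → Set ℝ) (hs : ∀ i, MeasurableSet (s i)) :
    volume.real {x : EuclideanSpace ℝ (Fin d) | ∀ i, x i ∈ s i} = ∏ i, volume.real (s i) := by
  have h := (PiLp.volume_preserving_ofLp (Fin d)).measure_preimage
    (MeasurableSet.univ_pi hs).nullMeasurableSet
  have he : {x : EuclideanSpace ℝ (Fin d) | ∀ i, x i ∈ s i}
      = WithLp.ofLp ⁻¹' (Set.univ.pi s) := by
    ext x; simp [Set.mem_pi]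
  rw [measureReal_def, he, h, volume_pi_pi, ENNReal.toReal_prod]
  rfl

theorem volume_real_unitCube (d : ℕ) : volume.real (unitCube d) = 1 := by
  have := volume_real_box (d := d) (fun _ => Set.Icc (0 : ℝ) 1) fun _ => measurableSet_Icc
  simpa [unitCube] using this

instance isFiniteMeasure_restrict_unitCube (d : ℕ) :
    IsFiniteMeasure (volume.restrict (unitCube d)) :=
  ⟨by simpa using (isCompact_unitCube d).measure_lt_top⟩

/-- The point `t` with its `i`-th coordinate replaced by `s`. -/
noncomputable def setCoord (t : EuclideanSpace ℝ (Fin d)) (i : Fin d) (s : ℝ) : EuclideanSpace ℝ (Fin d) :=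
  WithLp.toLp 2 (Function.update t.ofLp i s)

@[simp] theorem setCoord_same (t : EuclideanSpace ℝ (Fin d)) (i : Fin d) (s : ℝ) :
    setCoord t i s i = s := by simp [setCoord]

theorem setCoord_ne (t : EuclideanSpace ℝ (Fin d)) {i j : Fin d} (h : j ≠ i) (s : ℝ) :
    setCoord t i s j = t j := by simp [setCoord, h]

theorem setCoord_mem_unitCube {t : EuclideanSpace ℝ (Fin d)} (ht : t ∈ unitCube d) (i : Fin d)
    {s : ℝ} (hs : s ∈ Set.Icc (0 : ℝ) 1) : setCoord t i s ∈ unitCube d := by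
  intro j
  by_cases h : j = i
  · subst h; simpa using hs
  · rw [setCoord_ne t h]; exact ht j

theorem continuous_setCoord (t : EuclideanSpace ℝ (Fin d)) (i : Fin d) :
    Continuous (setCoord t i) :=
  (PiLp.continuous_toLp 2 (fun _ : Fin d => ℝ)).comp (continuous_const.update i continuous_id)

theorem hasDerivAt_setCoord (t : EuclideanSpace ℝ (Fin d)) (i : Fin d) (s : ℝ) :
    HasDerivAt (setCoord t i) (EuclideanSpace.single i 1) s :=
  (PiLp.hasFDerivAt_toLp (𝕜 := ℝ) (E := fun _ : Fin d => ℝ) 2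
    (Function.update t.ofLp i s)).comp_hasDerivAt s (hasDerivAt_update t.ofLp i s)

/-- The point with the coordinates of `x` in `R` and those of `t` outside `R`. -/
noncomputable def mergeCoords (R : Finset (Fin d)) (x t : EuclideanSpace ℝ (Fin d)) : EuclideanSpace ℝ (Fin d) :=
  WithLp.toLp 2 fun i => if i ∈ R then x i else t i

theorem mergeCoords_apply (R : Finset (Fin d)) (x t : EuclideanSpace ℝ (Fin d)) (i : Fin d) :
    mergeCoords R x t i = if i ∈ R then x i else t i := rfl

theorem mergeCoords_mem_unitCube (R : Finset (Fin d)) {x t : EuclideanSpace ℝ (Fin d)}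
    (hx : x ∈ unitCube d) (ht : t ∈ unitCube d) : mergeCoords R x t ∈ unitCube d := by
  intro i
  rw [mergeCoords_apply]
  split_ifs
  · exact hx i
  · exact ht i

theorem mergeCoords_empty (x t : EuclideanSpace ℝ (Fin d)) : mergeCoords ∅ x t = t := by
  ext i; simp [mergeCoords_apply]

theorem mergeCoords_univ (x t : EuclideanSpace ℝ (Fin d)) : mergeCoords Finset.univ x t = x := by
  ext i; simp [mergeCoords_apply]

theorem mergeCoords_setCoord {R : Finset (Fin d)} {i : Fin d} (hi : i ∉ R)
    (x t : EuclideanSpace ℝ (Fin d)) (s : ℝ) :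
    mergeCoords R x (setCoord t i s) = setCoord (mergeCoords R x t) i s := by
  ext j
  by_cases h : j = i
  · subst h; simp [mergeCoords_apply, hi]
  · simp [mergeCoords_apply, setCoord_ne _ h]

theorem mergeCoords_insert {R : Finset (Fin d)} {i : Fin d}
    (x t : EuclideanSpace ℝ (Fin d)) :
    mergeCoords (insert i R) x t = setCoord (mergeCoords R x t) i (x i) := by
  ext j
  by_cases h : j = i
  · subst h; simp [mergeCoords_apply]
  · simp [mergeCoords_apply, setCoord_ne _ h, h]

theorem continuous_mergeCoords (R : Finset (Fin d)) :
    Continuous fun p : EuclideanSpace ℝ (Fin d) × EuclideanSpace ℝ (Fin d) =>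
      mergeCoords R p.1 p.2 := by
  refine (PiLp.continuous_toLp 2 (fun _ : Fin d => ℝ)).comp (continuous_pi fun i => ?_)
  split_ifs <;> fun_prop

end Cube

/-! ### A parametric Koksma–Hlawka inequality. -/

section KoksmaHlawka

variable {d : ℕ} {F : Type*} [NormedAddCommGroup F] [NormedSpace ℝ F]

/-- The error of the equal-weight quadrature rule with nodes `X` on the unit cube. -/
noncomputable def quadratureError {n : ℕ} (X : Fin n → EuclideanSpace ℝ (Fin d))
    (g : EuclideanSpace ℝ (Fin d) → F) : F :=
  (1 / (n : ℝ)) • ∑ j, g (X j) - ∫ x in unitCube d, g x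

/-- The boxes `∏_{i ∉ R} [0, t_i) × ℝ^R`, where a factor with `t_i = 1` is the whole line. -/
def anchoredBox (R : Finset (Fin d)) (t : EuclideanSpace ℝ (Fin d)) :
    Set (EuclideanSpace ℝ (Fin d)) :=
  {x | ∀ i, i ∉ R → x i < t i ∨ t i = 1}

/-- The function `g` with its coordinates outside `R` frozen at `t`, cut off to a box. -/
noncomputable def anchored (R : Finset (Fin d)) (t : EuclideanSpace ℝ (Fin d))
    (g : EuclideanSpace ℝ (Fin d) → F) (x : EuclideanSpace ℝ (Fin d)) : F :=
  (anchoredBox R t).indicator (fun x => g (mergeCoords R x t)) x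

theorem measurableSet_anchoredBox_prod (R : Finset (Fin d)) :
    MeasurableSet {p : EuclideanSpace ℝ (Fin d) × EuclideanSpace ℝ (Fin d) |
      p.2 ∈ anchoredBox R p.1} := by
  have : {p : EuclideanSpace ℝ (Fin d) × EuclideanSpace ℝ (Fin d) | p.2 ∈ anchoredBox R p.1}
      = ⋂ (i : Fin d) (_ : i ∉ R), ({p | p.2 i < p.1 i} ∪ {p | p.1 i = 1}) := by
    ext p
    simp [anchoredBox]
  rw [this]
  refine MeasurableSet.iInter fun i => MeasurableSet.iInter fun _ => MeasurableSet.union ?_ ?_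
  · exact (isOpen_lt (by fun_prop) (by fun_prop)).measurableSet
  · exact (isClosed_eq (by fun_prop) (by fun_prop)).measurableSet

theorem measurableSet_anchoredBox (R : Finset (Fin d)) (t : EuclideanSpace ℝ (Fin d)) :
    MeasurableSet (anchoredBox R t) :=
  (measurableSet_anchoredBox_prod R).preimage (measurable_const.prodMk measurable_id)

theorem abs_card_div_sub_prod_le_starDiscrepancy {n : ℕ} (X : Fin n → EuclideanSpace ℝ (Fin d))
    {t : EuclideanSpace ℝ (Fin d)} (ht : t ∈ unitCube d) :
    |((Finset.univ.filter fun j : Fin n => ∀ i, X j i < t i).card : ℝ) / n - ∏ i, t i|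
      ≤ starDiscrepancy X := by
  refine le_ciSup (f := fun t : unitCube d =>
    |((Finset.univ.filter fun j : Fin n => ∀ i, X j i < t.1 i).card : ℝ) / n - ∏ i, t.1 i|)
    ⟨1, ?_⟩ ⟨t, ht⟩
  rintro _ ⟨s, rfl⟩
  have h1 : ((Finset.univ.filter fun j : Fin n => ∀ i, X j i < s.1 i).card : ℝ) / n ≤ 1 := by
    refine div_le_one_of_le₀ ?_ (Nat.cast_nonneg n)
    exact_mod_cast (Finset.card_filter_le _ _).trans (by simp)
  have h2 : 0 ≤ ((Finset.univ.filter fun j : Fin n => ∀ i, X j i < s.1 i).card : ℝ) / n := by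
    positivity
  have h3 : ∏ i, s.1 i ≤ 1 := Finset.prod_le_one (fun i _ => (s.2 i).1) fun i _ => (s.2 i).2
  have h4 : 0 ≤ ∏ i, s.1 i := Finset.prod_nonneg fun i _ => (s.2 i).1
  rw [abs_le]
  constructor <;> linarith

theorem starDiscrepancy_nonneg {n : ℕ} (X : Fin n → EuclideanSpace ℝ (Fin d)) :
    0 ≤ starDiscrepancy X :=
  Real.iSup_nonneg fun _ => abs_nonneg _

/-- Compared with `[0, t)`, the box gains only nodes with a coordinate at least 1. Testing the
discrepancy at `t = (1, …, 1)` shows that their proportion is at most `starDiscrepancy X`, whence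
the factor 2. -/
theorem abs_card_anchoredBox_sub_prod_le {n : ℕ} (hn : 0 < n)
    (X : Fin n → EuclideanSpace ℝ (Fin d))
    {t : EuclideanSpace ℝ (Fin d)} (ht : t ∈ unitCube d)
    [DecidablePred fun j : Fin n => X j ∈ anchoredBox ∅ t] :
    |((Finset.univ.filter fun j : Fin n => X j ∈ anchoredBox ∅ t).card : ℝ) / n - ∏ i, t i|
      ≤ 2 * starDiscrepancy X := by
  have hn' : (0 : ℝ) < n := by exact_mod_cast hn
  set A := Finset.univ.filter fun j : Fin n => X j ∈ anchoredBox ∅ t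
  set S := Finset.univ.filter fun j : Fin n => ∀ i, X j i < t i
  set O := Finset.univ.filter fun j : Fin n =>
    ∀ i, X j i < (WithLp.toLp 2 fun _ => (1 : ℝ) : EuclideanSpace ℝ (Fin d)) i
  have h1 := abs_card_div_sub_prod_le_starDiscrepancy X ht
  have h2 := abs_card_div_sub_prod_le_starDiscrepancy X
    (t := WithLp.toLp 2 fun _ => (1 : ℝ)) fun i => by simp
  change |(S.card : ℝ) / n - _| ≤ _ at h1
  change |(O.card : ℝ) / n - _| ≤ _ at h2
  have hSA : S ⊆ A := by
    intro j hj
    simp only [S, A, Finset.mem_filter, Finset.mem_univ, true_and] at hj ⊢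
    exact fun i _ => Or.inl (hj i)
  have hAS : A ⊆ S ∪ Oᶜ := by
    intro j hj
    simp only [S, A, O, Finset.mem_filter, Finset.mem_univ, true_and, Finset.mem_union,
      Finset.mem_compl] at hj ⊢
    by_contra! hcon
    obtain ⟨⟨i, hi⟩, ho⟩ := hcon
    rcases hj i (by simp) with h | h
    · exact absurd h (not_lt.2 hi)
    · exact absurd (ho i) (not_lt.2 (h ▸ hi))
  have c1 : (S.card : ℝ) ≤ A.card := by exact_mod_cast Finset.card_le_card hSA
  have c2 : (A.card : ℝ) ≤ S.card + (n - O.card) := by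
    have h := (Finset.card_le_card hAS).trans (Finset.card_union_le _ _)
    have h' := Finset.card_add_card_compl O
    rw [Fintype.card_fin] at h'
    have : (O.card : ℝ) + (Oᶜ.card : ℝ) = n := by exact_mod_cast h'
    have : (A.card : ℝ) ≤ S.card + Oᶜ.card := by exact_mod_cast h
    linarith
  have c3 : (S.card : ℝ) / n ≤ A.card / n := by gcongr
  have c4 : (A.card : ℝ) / n ≤ S.card / n + (1 - O.card / n) := by
    calc (A.card : ℝ) / n ≤ (S.card + (n - O.card)) / n := by gcongr
      _ = _ := by field_simp
  simp only [Finset.prod_const_one] at h2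
  have h0 := starDiscrepancy_nonneg X
  rw [abs_le] at *
  constructor <;> linarith

theorem setIntegral_indicator_anchoredBox [CompleteSpace F] {t : EuclideanSpace ℝ (Fin d)} (ht : t ∈ unitCube d)
    (a : F) :
    ∫ x in unitCube d, (anchoredBox ∅ t).indicator (fun _ => a) x = (∏ i, t i) • a := by
  classical
  rw [setIntegral_indicator (measurableSet_anchoredBox _ _), setIntegral_const]
  congr 1
  -- Either kind of factor, `[0, 1]` with `t i = 1` or `[0, t i)`, has length `t i`.
  have : unitCube d ∩ anchoredBox ∅ t
      = {x | ∀ i, x i ∈ if t i = 1 then Set.Icc (0 : ℝ) 1 else Set.Ico 0 (t i)} := by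
    ext x
    simp only [anchoredBox, unitCube, Set.mem_inter_iff, Set.mem_ofPred_eq, Finset.notMem_empty,
      not_false_eq_true, true_implies, ← forall_and]
    refine forall_congr' fun i => ?_
    split_ifs with h
    · simp [h]
    · simp only [h, or_false, Set.mem_Icc, Set.mem_Ico]
      exact ⟨fun h => ⟨h.1.1, h.2⟩, fun h => ⟨⟨h.1, h.2.le.trans (ht i).2⟩, h.2⟩⟩
  rw [this, volume_real_box]
  · refine Finset.prod_congr rfl fun i _ => ?_
    split_ifs with h
    · simp [h]
    · simp [(ht i).1]
  · intro i
    split_ifs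
    · exact measurableSet_Icc
    · exact measurableSet_Ico

theorem norm_quadratureError_anchored_empty_le [CompleteSpace F] {n : ℕ} (hn : 0 < n)
    (X : Fin n → EuclideanSpace ℝ (Fin d))
    {t : EuclideanSpace ℝ (Fin d)} (ht : t ∈ unitCube d) (g : EuclideanSpace ℝ (Fin d) → F) :
    ‖quadratureError X (anchored ∅ t g)‖ ≤ 2 * starDiscrepancy X * ‖g t‖ := by
  classical
  have hfun : anchored ∅ t g = (anchoredBox ∅ t).indicator fun _ => g t := by
    funext x
    simp only [anchored, mergeCoords_empty]
  have hsum : ∑ j, (anchoredBox ∅ t).indicator (fun _ => g t) (X j)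
      = ((Finset.univ.filter fun j : Fin n => X j ∈ anchoredBox ∅ t).card : ℝ) • g t := by
    simp only [Set.indicator_apply]
    rw [← Finset.sum_filter, Finset.sum_const, Nat.cast_smul_eq_nsmul]
  rw [quadratureError, hfun, setIntegral_indicator_anchoredBox ht, hsum, smul_smul, ← sub_smul,
    norm_smul, Real.norm_eq_abs]
  gcongr
  rw [one_div_mul_eq_div]
  exact abs_card_anchoredBox_sub_prod_le hn X ht

omit [NormedSpace ℝ F] in
theorem continuousOn_comp_mergeCoords {g : EuclideanSpace ℝ (Fin d) → F}
    (hg : ContinuousOn g (unitCube d)) (R : Finset (Fin d)) (t : EuclideanSpace ℝ (Fin d))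
    (ht : t ∈ unitCube d) (i : Fin d) :
    ContinuousOn (fun p : ℝ × EuclideanSpace ℝ (Fin d) => g (mergeCoords R p.2 (setCoord t i p.1)))
      (Set.Icc (0 : ℝ) 1 ×ˢ unitCube d) := by
  refine hg.comp (Continuous.continuousOn ?_) ?_
  · exact (continuous_mergeCoords R).comp
      (continuous_snd.prodMk ((continuous_setCoord t i).comp continuous_fst))
  · rintro ⟨s, x⟩ ⟨hs, hx⟩
    exact mergeCoords_mem_unitCube R hx (setCoord_mem_unitCube ht i hs)

omit [NormedSpace ℝ F] in
-- Joint integrability, for exchanging the integrals over `s` and over the cube.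
theorem integrable_anchored_setCoord {g : EuclideanSpace ℝ (Fin d) → F}
    (hg : ContinuousOn g (unitCube d)) (R : Finset (Fin d)) {t : EuclideanSpace ℝ (Fin d)}
    (ht : t ∈ unitCube d) (i : Fin d) :
    Integrable (Function.uncurry fun (s : ℝ) x => anchored R (setCoord t i s) g x)
      ((volume.restrict (Set.Ioc (0 : ℝ) 1)).prod (volume.restrict (unitCube d))) := by
  have hS : MeasurableSet {p : ℝ × EuclideanSpace ℝ (Fin d) |
      p.2 ∈ anchoredBox R (setCoord t i p.1)} :=
    (measurableSet_anchoredBox_prod R).preimage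
      (((continuous_setCoord t i).measurable.comp measurable_fst).prodMk measurable_snd)
  have hc := continuousOn_comp_mergeCoords hg R t ht i
  have hm : Integrable (fun p : ℝ × EuclideanSpace ℝ (Fin d) =>
      g (mergeCoords R p.2 (setCoord t i p.1)))
      ((volume.restrict (Set.Ioc (0 : ℝ) 1)).prod (volume.restrict (unitCube d))) := by
    rw [Measure.prod_restrict]
    exact (hc.integrableOn_compact (isCompact_Icc.prod (isCompact_unitCube d))).mono_set
      (Set.prod_mono Set.Ioc_subset_Icc_self subset_rfl)
  refine (hm.indicator hS).congr (Eventually.of_forall fun p => ?_)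
  simp only [Function.uncurry, anchored]
  rfl

omit [NormedSpace ℝ F] in
theorem integrableOn_anchored {g : EuclideanSpace ℝ (Fin d) → F}
    (hg : ContinuousOn g (unitCube d)) (R : Finset (Fin d)) {t : EuclideanSpace ℝ (Fin d)}
    (ht : t ∈ unitCube d) : IntegrableOn (anchored R t g) (unitCube d) := by
  refine IntegrableOn.indicator ?_ (measurableSet_anchoredBox R t)
  refine ContinuousOn.integrableOn_compact (isCompact_unitCube d) ?_
  exact hg.comp ((continuous_mergeCoords R).comp (continuous_id.prodMk continuous_const)).continuousOn
    fun x hx => mergeCoords_mem_unitCube R hx ht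

/-- One step of the Hlawka–Zaremba identity. -/
theorem anchored_insert [CompleteSpace F] {g g' : EuclideanSpace ℝ (Fin d) → F} {i : Fin d}
    (hg' : ContinuousOn g' (unitCube d))
    (hder : ∀ x ∈ unitCube d, ∀ s ∈ Set.Icc (0 : ℝ) 1,
      HasDerivWithinAt (fun s => g (setCoord x i s)) (g' (setCoord x i s)) (Set.Icc 0 1) s)
    {R : Finset (Fin d)} (hi : i ∉ R) {t : EuclideanSpace ℝ (Fin d)} (ht : t ∈ unitCube d)
    {x : EuclideanSpace ℝ (Fin d)} (hx : x ∈ unitCube d) :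
    anchored (insert i R) t g x = anchored R (setCoord t i 1) g x
      - ∫ s in (0 : ℝ)..1, anchored R (setCoord t i s) g' x := by
  classical
  have hmem : ∀ s, x ∈ anchoredBox R (setCoord t i s) ↔
      x ∈ anchoredBox (insert i R) t ∧ (x i < s ∨ s = 1) := by
    intro s
    constructor
    · intro h
      refine ⟨fun j hj => ?_, by simpa using h i hi⟩
      rw [Finset.mem_insert, not_or] at hj
      simpa [setCoord_ne t hj.1] using h j hj.2
    · rintro ⟨h, h'⟩ j hj
      by_cases hji : j = i
      · subst hji; simpa using h'
      · simpa [setCoord_ne t hji] using h j (by simp [hji, hj])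
  by_cases hb : x ∈ anchoredBox (insert i R) t
  · have hm : mergeCoords R x t ∈ unitCube d := mergeCoords_mem_unitCube R hx ht
    have hc : ContinuousOn (fun s => g' (setCoord (mergeCoords R x t) i s)) (Set.Icc 0 1) :=
      hg'.comp (continuous_setCoord _ i).continuousOn fun s hs => setCoord_mem_unitCube hm i hs
    have hftc : ∫ s in (x i)..1, g' (setCoord (mergeCoords R x t) i s)
        = g (setCoord (mergeCoords R x t) i 1) - g (setCoord (mergeCoords R x t) i (x i)) := by
      have hsub : Set.Icc (x i) 1 ⊆ Set.Icc 0 1 := Set.Icc_subset_Icc_left (hx i).1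
      refine intervalIntegral.integral_eq_sub_of_hasDeriv_right_of_le
        (f := fun s => g (setCoord (mergeCoords R x t) i s)) (hx i).2 ?_ ?_ ?_
      · exact fun s hs => ((hder _ hm s (hsub hs)).continuousWithinAt).mono hsub
      · intro s hs
        have hs' := Set.Ioo_subset_Ioo_left (hx i).1 hs
        refine ((hder _ hm s (Set.Ioo_subset_Icc_self hs')).hasDerivAt ?_).hasDerivWithinAt
        exact Icc_mem_nhds hs'.1 hs'.2
      · exact (hc.mono (by rw [Set.uIcc_of_le (hx i).2]; exact hsub)).intervalIntegrable
    have h1 : anchored (insert i R) t g x = g (setCoord (mergeCoords R x t) i (x i)) := by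
      rw [anchored, Set.indicator_of_mem hb, mergeCoords_insert]
    have h2 : anchored R (setCoord t i 1) g x = g (setCoord (mergeCoords R x t) i 1) := by
      rw [anchored, Set.indicator_of_mem ((hmem 1).2 ⟨hb, Or.inr rfl⟩), mergeCoords_setCoord hi]
    have h3 : ∫ s in (0 : ℝ)..1, anchored R (setCoord t i s) g' x
        = ∫ s in (x i)..1, g' (setCoord (mergeCoords R x t) i s) := by
      -- Open intervals discard `s = 1`, where the box convention switches the cutoff on regardless
      -- of `x i`.
      rw [intervalIntegral.integral_of_le zero_le_one, intervalIntegral.integral_of_le (hx i).2,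
        integral_Ioc_eq_integral_Ioo, integral_Ioc_eq_integral_Ioo]
      have : ∀ s ∈ Set.Ioo (0 : ℝ) 1, anchored R (setCoord t i s) g' x
          = (Set.Ioi (x i)).indicator (fun s => g' (setCoord (mergeCoords R x t) i s)) s := by
        intro s hs
        simp only [anchored, Set.indicator_apply, hmem, hb, true_and, hs.2.ne, or_false,
          Set.mem_Ioi, mergeCoords_setCoord hi]
      rw [setIntegral_congr_fun measurableSet_Ioo this, setIntegral_indicator measurableSet_Ioi]
      congr 2
      ext s
      have := (hx i).1
      simp only [Set.mem_inter_iff, Set.mem_Ioo, Set.mem_Ioi]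
      constructor
      · rintro ⟨⟨_, h⟩, h'⟩; exact ⟨h', h⟩
      · rintro ⟨h', h⟩; exact ⟨⟨by linarith, h⟩, h'⟩
    rw [h1, h2, h3, hftc]
    abel
  -- If `x` violates a constraint in another coordinate, every term vanishes.
  · have h1 : ∀ (s : ℝ) (h : EuclideanSpace ℝ (Fin d) → F), anchored R (setCoord t i s) h x = 0 :=
      fun s h => Set.indicator_of_notMem (fun hs => hb ((hmem s).1 hs).1) _
    rw [h1, anchored, Set.indicator_of_notMem hb]
    simp [h1]

/-- The quadrature error is linear and, by Fubini, commutes with the integral over `s`, so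
`anchored_insert` passes through it. -/
theorem quadratureError_anchored_insert [CompleteSpace F]
    {g g' : EuclideanSpace ℝ (Fin d) → F} {i : Fin d}
    (hg : ContinuousOn g (unitCube d)) (hg' : ContinuousOn g' (unitCube d))
    (hder : ∀ x ∈ unitCube d, ∀ s ∈ Set.Icc (0 : ℝ) 1,
      HasDerivWithinAt (fun s => g (setCoord x i s)) (g' (setCoord x i s)) (Set.Icc 0 1) s)
    {R : Finset (Fin d)} (hi : i ∉ R) {t : EuclideanSpace ℝ (Fin d)} (ht : t ∈ unitCube d)
    {n : ℕ} (X : Fin n → EuclideanSpace ℝ (Fin d)) (hX : ∀ j, X j ∈ unitCube d) :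
    quadratureError X (anchored (insert i R) t g)
      = quadratureError X (anchored R (setCoord t i 1) g)
        - ∫ s in (0 : ℝ)..1, quadratureError X (anchored R (setCoord t i s) g') := by
  have hint := integrable_anchored_setCoord hg' R ht i
  have hright : Integrable (fun x => ∫ s in Set.Ioc (0 : ℝ) 1, anchored R (setCoord t i s) g' x)
      (volume.restrict (unitCube d)) := hint.integral_prod_right
  have hleft : Integrable (fun s => ∫ x in unitCube d, anchored R (setCoord t i s) g' x)
      (volume.restrict (Set.Ioc (0 : ℝ) 1)) := hint.integral_prod_left
  have hpt : ∀ x ∈ unitCube d, anchored (insert i R) t g x = anchored R (setCoord t i 1) g x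
      - ∫ s in Set.Ioc (0 : ℝ) 1, anchored R (setCoord t i s) g' x := by
    intro x hx
    rw [anchored_insert hg' hder hi ht hx, intervalIntegral.integral_of_le zero_le_one]
  have hsec : ∀ x ∈ unitCube d, Integrable (fun s => anchored R (setCoord t i s) g' x)
      (volume.restrict (Set.Ioc (0 : ℝ) 1)) := by
    intro x hx
    have hS : MeasurableSet {s : ℝ | x ∈ anchoredBox R (setCoord t i s)} :=
      (measurableSet_anchoredBox_prod R).preimage
        ((continuous_setCoord t i).measurable.prodMk measurable_const)
    have hc : ContinuousOn (fun s => g' (mergeCoords R x (setCoord t i s))) (Set.Icc (0 : ℝ) 1) :=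
      (continuousOn_comp_mergeCoords hg' R t ht i).comp
        (continuous_id.prodMk continuous_const).continuousOn fun s hs => ⟨hs, hx⟩
    have hm : Integrable (fun s => g' (mergeCoords R x (setCoord t i s)))
        (volume.restrict (Set.Ioc (0 : ℝ) 1)) :=
      (hc.integrableOn_compact isCompact_Icc).mono_set Set.Ioc_subset_Icc_self
    refine (hm.indicator hS).congr (Eventually.of_forall fun s => ?_)
    simp only [anchored]
    rfl
  have hsum : Integrable (fun s => (1 / (n : ℝ)) • ∑ j, anchored R (setCoord t i s) g' (X j))
      (volume.restrict (Set.Ioc (0 : ℝ) 1)) :=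
    (integrable_finsetSum _ fun j _ => hsec (X j) (hX j)).smul (1 / (n : ℝ))
  rw [intervalIntegral.integral_of_le zero_le_one]
  simp only [quadratureError]
  rw [setIntegral_congr_fun (measurableSet_unitCube d) hpt,
    integral_sub (integrableOn_anchored hg R (setCoord_mem_unitCube ht i (by simp)))
      hright,
    Finset.sum_congr rfl fun j _ => hpt (X j) (hX j), Finset.sum_sub_distrib,
    integral_sub hsum hleft, integral_smul, integral_finsetSum _ fun j _ => hsec (X j) (hX j),
    integral_integral_swap hint]
  module

/-- A Koksma–Hlawka inequality with partially frozen coordinates, uniform over a compact set of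
parameters. -/
theorem exists_norm_quadratureError_anchored_le [CompleteSpace F]
    {E : Type*} [NormedAddCommGroup E] [NormedSpace ℝ E] {K : Set E} (hK : IsCompact K)
    (R : Finset (Fin d)) :
    ∀ (H : E × EuclideanSpace ℝ (Fin d) → F),
      ContDiffOn ℝ R.card H (Set.univ ×ˢ unitCube d) →
      ∃ M : ℝ, 0 ≤ M ∧ ∀ θ ∈ K, ∀ t ∈ unitCube d, ∀ n : ℕ, 0 < n →
        ∀ X : Fin n → EuclideanSpace ℝ (Fin d), (∀ j, X j ∈ unitCube d) →
          ‖quadratureError X (anchored R t fun x => H (θ, x))‖ ≤ M * starDiscrepancy X := by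
  have hunique : UniqueDiffOn ℝ ((Set.univ : Set E) ×ˢ unitCube d) :=
    uniqueDiffOn_univ.prod (uniqueDiffOn_unitCube d)
  have hsection : ∀ {H : E × EuclideanSpace ℝ (Fin d) → F},
      ContinuousOn H (Set.univ ×ˢ unitCube d) → ∀ θ : E,
        ContinuousOn (fun x => H (θ, x)) (unitCube d) := fun hH θ =>
    hH.comp (continuous_const.prodMk continuous_id).continuousOn fun x hx => ⟨Set.mem_univ _, hx⟩
  -- `R` holds the coordinates still live. Freezing one of them costs one derivative, so `R.card`
  -- orders of smoothness suffice.
  induction R using Finset.induction_on with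
  | empty =>
    intro H hH
    obtain ⟨M, hM⟩ := (hK.prod (isCompact_unitCube d)).exists_bound_of_continuousOn
      (hH.continuousOn.mono (Set.prod_mono (Set.subset_univ K) subset_rfl))
    refine ⟨2 * max M 0, by positivity, fun θ hθ t ht n hn X hX => ?_⟩
    refine (norm_quadratureError_anchored_empty_le hn X ht _).trans ?_
    have h0 := starDiscrepancy_nonneg X
    have h1 : ‖H (θ, t)‖ ≤ max M 0 := (hM (θ, t) ⟨hθ, ht⟩).trans (le_max_left _ _)
    nlinarith
  | insert i R hi ih =>
    intro H hH
    rw [Finset.card_insert_of_notMem hi] at hH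
    have hH' : ContDiffOn ℝ R.card (fun p => fderivWithin ℝ H (Set.univ ×ˢ unitCube d) p
        ((0 : E), EuclideanSpace.single i (1 : ℝ))) (Set.univ ×ˢ unitCube d) :=
      (hH.fderivWithin hunique (by norm_cast)).clm_apply contDiffOn_const
    obtain ⟨M₁, hM₁, h₁⟩ := ih H (hH.of_le (by norm_cast; omega))
    obtain ⟨M₂, hM₂, h₂⟩ := ih _ hH'
    refine ⟨M₁ + M₂, by positivity, fun θ hθ t ht n hn X hX => ?_⟩
    rw [quadratureError_anchored_insert (hsection hH.continuousOn θ)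
      (hsection hH'.continuousOn θ) ?_ hi ht X hX]
    · refine (norm_sub_le _ _).trans ?_
      rw [add_mul]
      refine add_le_add (h₁ θ hθ _ (setCoord_mem_unitCube ht i (by simp)) n hn X hX) ?_
      refine (intervalIntegral.norm_integral_le_of_norm_le_const (fun s hs => ?_)).trans
        (by rw [sub_zero, abs_one, mul_one])
      rw [Set.uIoc_of_le zero_le_one] at hs
      exact h₂ θ hθ _ (setCoord_mem_unitCube ht i (Set.Ioc_subset_Icc_self hs)) n hn X hX
    · intro x hx s hs
      have hd := (hH.differentiableOn (by norm_cast)) (θ, setCoord x i s)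
        ⟨Set.mem_univ _, setCoord_mem_unitCube hx i hs⟩
      have hmaps : Set.MapsTo (fun r => (θ, setCoord x i r)) (Set.Icc (0 : ℝ) 1)
          ((Set.univ : Set E) ×ˢ unitCube d) :=
        fun r hr => ⟨Set.mem_univ _, setCoord_mem_unitCube hx i hr⟩
      exact hd.hasFDerivWithinAt.comp_hasDerivWithinAt s
        ((hasDerivAt_const s θ).prodMk (hasDerivAt_setCoord x i s)).hasDerivWithinAt hmaps

/-- The Koksma–Hlawka inequality for a family of `C^d` functions, uniform over a compact set of
parameters. -/
theorem exists_norm_quadratureError_le [CompleteSpace F]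
    {E : Type*} [NormedAddCommGroup E] [NormedSpace ℝ E] {K : Set E} (hK : IsCompact K)
    {H : E × EuclideanSpace ℝ (Fin d) → F} (hH : ContDiffOn ℝ d H (Set.univ ×ˢ unitCube d)) :
    ∃ M : ℝ, 0 ≤ M ∧ ∀ θ ∈ K, ∀ n : ℕ, 0 < n →
      ∀ X : Fin n → EuclideanSpace ℝ (Fin d), (∀ j, X j ∈ unitCube d) →
        ‖quadratureError X fun x => H (θ, x)‖ ≤ M * starDiscrepancy X := by
  obtain ⟨M, hM, h⟩ := exists_norm_quadratureError_anchored_le hK (Finset.univ : Finset (Fin d)) H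
    (by simpa using hH)
  refine ⟨M, hM, fun θ hθ n hn X hX => ?_⟩
  -- With all coordinates live the frozen point plays no role; any point of the cube would do.
  have := h θ hθ 0 (fun i => by simp) n hn X hX
  convert this using 3
  funext x
  rw [anchored, Set.indicator_of_mem (fun i hi => absurd (Finset.mem_univ i) hi),
    mergeCoords_univ]

end KoksmaHlawka

open scoped ContDiff

/-! ### Joint smoothness of the network in weights and input. -/

section Smoothness

theorem contDiff_swish : ContDiff ℝ ∞ swish := by
  have h : ∀ x : ℝ, 1 + Real.exp (-x) ≠ 0 := fun x => by positivity
  exact contDiff_id.div (contDiff_const.add contDiff_neg.exp) h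

/-- Weights and input both depend on `e`, because the input of a deeper layer is itself a function
of the earlier weights. -/
theorem contDiff_evalNet {E : Type*} [NormedAddCommGroup E] [NormedSpace ℝ E] (ws : List ℕ) :
    ∀ (m : ℕ) (θ : E → WeightIndex m ws → ℝ) (x : E → Fin m → ℝ),
      (∀ p, ContDiff ℝ ∞ fun e => θ e p) → (∀ i, ContDiff ℝ ∞ fun e => x e i) →
        ContDiff ℝ ∞ fun e => evalNet m ws (θ e) (x e) := by
  induction ws with
  | nil =>
    intro m θ x hθ hx
    exact (ContDiff.sum fun j _ => (hθ (Sum.inl j)).mul (hx j)).add (hθ (Sum.inr ()))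
  | cons w ws ih =>
    intro m θ x hθ hx
    refine ih w (fun e p => θ e (Sum.inr (Sum.inr p)))
      (fun e i => swish ((∑ j, θ e (Sum.inl (i, j)) * x e j) + θ e (Sum.inr (Sum.inl i))))
      (fun p => hθ _) fun i => contDiff_swish.comp ?_
    exact (ContDiff.sum fun j _ => (hθ (Sum.inl (i, j))).mul (hx j)).add
      (hθ (Sum.inr (Sum.inl i)))

variable {d : ℕ} {ws : List ℕ}

theorem contDiff_net :
    ContDiff ℝ ∞ fun p : Weights d ws × EuclideanSpace ℝ (Fin d) => net p.1 p.2 := by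
  refine contDiff_evalNet ws d _ _ (fun p => ?_) fun i => ?_ <;> fun_prop

theorem contDiff_half_norm_gradient_net_sq :
    ContDiff ℝ ∞ fun p : Weights d ws × EuclideanSpace ℝ (Fin d) =>
      1 / 2 * ‖gradient (net p.1) p.2‖ ^ 2 := by
  have h : ContDiff ℝ ∞ fun p : Weights d ws × EuclideanSpace ℝ (Fin d) =>
      fderiv ℝ (net p.1) p.2 :=
    ContDiff.fderiv (f := fun (p : Weights d ws × EuclideanSpace ℝ (Fin d)) x => net p.1 x)
      (m := ∞) (contDiff_net.comp (by fun_prop :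
        ContDiff ℝ ∞ fun q : (Weights d ws × EuclideanSpace ℝ (Fin d)) × EuclideanSpace ℝ (Fin d) =>
          (q.1.1, q.2))) contDiff_snd (by simp)
  exact contDiff_const.mul
    (((InnerProductSpace.toDual ℝ _).symm.contDiff.comp h).norm_sq ℝ)

end Smoothness

/-! ### Derivatives in the parameter and under the integral sign. -/

section Parametric

variable {d : ℕ} {E : Type*} [NormedAddCommGroup E] [NormedSpace ℝ E]

/-- The partial derivative of `w` in its first variable. -/
noncomputable def partialFDeriv (w : E × EuclideanSpace ℝ (Fin d) → ℝ)
    (p : E × EuclideanSpace ℝ (Fin d)) : E →L[ℝ] ℝ :=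
  fderiv ℝ (fun ϑ => w (ϑ, p.2)) p.1

theorem contDiff_partialFDeriv {w : E × EuclideanSpace ℝ (Fin d) → ℝ} (hw : ContDiff ℝ ∞ w) :
    ContDiff ℝ ∞ (partialFDeriv w) :=
  ContDiff.fderiv (f := fun (p : E × EuclideanSpace ℝ (Fin d)) ϑ => w (ϑ, p.2)) (m := ∞)
    (hw.comp (by fun_prop :
      ContDiff ℝ ∞ fun q : (E × EuclideanSpace ℝ (Fin d)) × E => (q.2, q.1.2)))
    contDiff_fst (by simp)

theorem hasFDerivAt_partialFDeriv {w : E × EuclideanSpace ℝ (Fin d) → ℝ} (hw : ContDiff ℝ ∞ w)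
    (θ : E) (x : EuclideanSpace ℝ (Fin d)) :
    HasFDerivAt (fun ϑ => w (ϑ, x)) (partialFDeriv w (θ, x)) θ :=
  (((hw.differentiable (by simp)).comp (by fun_prop :
    Differentiable ℝ fun ϑ : E => (ϑ, x))) θ).hasFDerivAt

/-- Differentiation under the integral sign over the unit cube. -/
theorem hasFDerivAt_setIntegral_unitCube [ProperSpace E]
    {w : E × EuclideanSpace ℝ (Fin d) → ℝ} {w' : E × EuclideanSpace ℝ (Fin d) → E →L[ℝ] ℝ}
    (hw : ContinuousOn w (Set.univ ×ˢ unitCube d))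
    (hw' : ContinuousOn w' (Set.univ ×ˢ unitCube d))
    (hd : ∀ θ, ∀ x ∈ unitCube d, HasFDerivAt (fun ϑ => w (ϑ, x)) (w' (θ, x)) θ) (θ : E) :
    HasFDerivAt (fun ϑ => ∫ x in unitCube d, w (ϑ, x)) (∫ x in unitCube d, w' (θ, x)) θ := by
  have hmk : ∀ ϑ : E, ContinuousOn (fun x : EuclideanSpace ℝ (Fin d) => (ϑ, x)) (unitCube d) :=
    fun ϑ => (continuous_const.prodMk continuous_id).continuousOn
  have hmaps : ∀ ϑ : E, Set.MapsTo (fun x : EuclideanSpace ℝ (Fin d) => (ϑ, x)) (unitCube d)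
      (Set.univ ×ˢ unitCube d) := fun ϑ x hx => ⟨Set.mem_univ _, hx⟩
  -- Compactness of the ball times the cube provides a constant dominating function.
  obtain ⟨M, hM⟩ := ((isCompact_closedBall θ 1).prod
    (isCompact_unitCube d)).exists_bound_of_continuousOn
      (hw'.mono (Set.prod_mono (Set.subset_univ _) subset_rfl))
  refine hasFDerivAt_integral_of_dominated_of_fderiv_le (bound := fun _ => M)
    (F := fun ϑ x => w (ϑ, x)) (F' := fun ϑ x => w' (ϑ, x))
    (Metric.closedBall_mem_nhds θ one_pos) (Eventually.of_forall fun ϑ => ?_) ?_ ?_ ?_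
    (integrable_const M) ?_
  · exact (hw.comp (hmk ϑ) (hmaps ϑ)).aestronglyMeasurable (measurableSet_unitCube d)
  · exact (hw.comp (hmk θ) (hmaps θ)).integrableOn_compact (isCompact_unitCube d)
  · exact (hw'.comp (hmk θ) (hmaps θ)).aestronglyMeasurable_of_isCompact
      (isCompact_unitCube d) (measurableSet_unitCube d)
  · exact (ae_restrict_iff' (measurableSet_unitCube d)).2
      (Eventually.of_forall fun x hx ϑ hϑ => hM (ϑ, x) ⟨hϑ, hx⟩)
  · exact (ae_restrict_iff' (measurableSet_unitCube d)).2
      (Eventually.of_forall fun x hx ϑ _ => hd ϑ x hx)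

end Parametric

/-! ### Gradients of the exact and empirical losses, and their difference. -/

section Gradients

variable {d : ℕ} {ws : List ℕ}

/-- The integrand of the energy part of the loss. -/
noncomputable def energyDensity (f : EuclideanSpace ℝ (Fin d) → ℝ)
    (p : Weights d ws × EuclideanSpace ℝ (Fin d)) : ℝ :=
  1 / 2 * ‖gradient (net p.1) p.2‖ ^ 2 - f p.2 * net p.1 p.2

/-- The derivative in the weights of the network function. -/
noncomputable def netDeriv (p : Weights d ws × EuclideanSpace ℝ (Fin d)) :
    Weights d ws →L[ℝ] ℝ :=
  partialFDeriv (fun p : Weights d ws × EuclideanSpace ℝ (Fin d) => net p.1 p.2) p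

/-- The derivative in the weights of the energy density. -/
noncomputable def energyDensityDeriv (f : EuclideanSpace ℝ (Fin d) → ℝ)
    (p : Weights d ws × EuclideanSpace ℝ (Fin d)) : Weights d ws →L[ℝ] ℝ :=
  partialFDeriv (fun p : Weights d ws × EuclideanSpace ℝ (Fin d) =>
    1 / 2 * ‖gradient (net p.1) p.2‖ ^ 2) p - f p.2 • netDeriv p

theorem contDiff_netDeriv : ContDiff ℝ ∞ (netDeriv (d := d) (ws := ws)) :=
  contDiff_partialFDeriv contDiff_net

theorem hasFDerivAt_net (θ : Weights d ws) (x : EuclideanSpace ℝ (Fin d)) :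
    HasFDerivAt (fun ϑ : Weights d ws => net ϑ x) (netDeriv (θ, x)) θ :=
  hasFDerivAt_partialFDeriv contDiff_net θ x

theorem hasFDerivAt_energyDensity (f : EuclideanSpace ℝ (Fin d) → ℝ) (θ : Weights d ws)
    (x : EuclideanSpace ℝ (Fin d)) :
    HasFDerivAt (fun ϑ : Weights d ws => energyDensity f (ϑ, x)) (energyDensityDeriv f (θ, x)) θ :=
  (hasFDerivAt_partialFDeriv contDiff_half_norm_gradient_net_sq θ x).sub
    ((hasFDerivAt_net θ x).const_mul (f x))

variable {f : EuclideanSpace ℝ (Fin d) → ℝ}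

theorem contDiffOn_comp_snd {n : ℕ∞} (hf : ContDiffOn ℝ n f (unitCube d)) :
    ContDiffOn ℝ n (fun p : Weights d ws × EuclideanSpace ℝ (Fin d) => f p.2)
      (Set.univ ×ˢ unitCube d) :=
  hf.comp contDiff_snd.contDiffOn fun _ hp => hp.2

theorem contDiffOn_energyDensity {n : ℕ∞} (hf : ContDiffOn ℝ n f (unitCube d)) :
    ContDiffOn ℝ n (energyDensity (ws := ws) f) (Set.univ ×ˢ unitCube d) :=
  (contDiff_half_norm_gradient_net_sq.of_le (by exact_mod_cast le_top)).contDiffOn.sub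
    ((contDiffOn_comp_snd hf).mul (contDiff_net.of_le (by exact_mod_cast le_top)).contDiffOn)

/-- Differentiating in the weights does not touch `f`, so no order of smoothness is lost. -/
theorem contDiffOn_energyDensityDeriv {n : ℕ∞} (hf : ContDiffOn ℝ n f (unitCube d)) :
    ContDiffOn ℝ n (energyDensityDeriv (ws := ws) f) (Set.univ ×ˢ unitCube d) :=
  ((contDiff_partialFDeriv contDiff_half_norm_gradient_net_sq).of_le
    (by exact_mod_cast le_top)).contDiffOn.sub
      ((contDiffOn_comp_snd hf).smul (contDiff_netDeriv.of_le (by exact_mod_cast le_top)).contDiffOn)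

theorem hasFDerivAt_poissonLoss {n : ℕ∞} (hf : ContDiffOn ℝ n f (unitCube d))
    (θ : Weights d ws) :
    HasFDerivAt (poissonLoss f)
      ((∫ x in unitCube d, energyDensityDeriv f (θ, x))
        + (∫ x in unitCube d, net θ x) • ∫ x in unitCube d, netDeriv (θ, x)) θ := by
  have h₁ := hasFDerivAt_setIntegral_unitCube (contDiffOn_energyDensity (ws := ws) hf).continuousOn
    (contDiffOn_energyDensityDeriv hf).continuousOn
    (fun ϑ x _ => hasFDerivAt_energyDensity f ϑ x) θ
  have h₂ := hasFDerivAt_setIntegral_unitCube (contDiff_net (d := d) (ws := ws)).continuous.continuousOn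
    contDiff_netDeriv.continuous.continuousOn (fun ϑ x _ => hasFDerivAt_net ϑ x) θ
  refine (h₁.add ((h₂.pow 2).const_mul (1 / 2 : ℝ))).congr_fderiv ?_
  congr 1
  rw [smul_smul]
  congr 1
  norm_num
  ring

theorem hasFDerivAt_empiricalFunctional {n : ℕ} (X : Fin n → EuclideanSpace ℝ (Fin d))
    (f : EuclideanSpace ℝ (Fin d) → ℝ) (θ : Weights d ws) :
    HasFDerivAt (fun ϑ : Weights d ws => empiricalFunctional X f (net ϑ))
      ((1 / (n : ℝ)) • ∑ j, energyDensityDeriv f (θ, X j)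
        + ((1 / (n : ℝ)) * ∑ j, net θ (X j)) • ((1 / (n : ℝ)) • ∑ j, netDeriv (θ, X j))) θ := by
  have h₁ := (HasFDerivAt.fun_sum (u := Finset.univ) fun j _ =>
    hasFDerivAt_energyDensity f θ (X j)).const_mul (1 / (n : ℝ))
  have h₂ := (HasFDerivAt.fun_sum (u := Finset.univ) fun j _ =>
    hasFDerivAt_net θ (X j)).const_mul (1 / (n : ℝ))
  refine (h₁.add ((h₂.pow 2).const_mul (1 / 2 : ℝ))).congr_fderiv ?_
  congr 1
  rw [smul_smul]
  congr 1
  norm_num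
  ring

theorem exists_norm_gradEstimator_sub_gradient_le (hf : ContDiffOn ℝ d f (unitCube d))
    {K : Set (Weights d ws)} (hK : IsCompact K) :
    ∃ M : ℝ, 0 ≤ M ∧ ∀ θ ∈ K, ∀ n : ℕ, 0 < n →
      ∀ X : Fin n → EuclideanSpace ℝ (Fin d), (∀ j, X j ∈ unitCube d) →
        ‖gradEstimator f X θ - gradient (poissonLoss f) θ‖ ≤ M * starDiscrepancy X := by
  have hd : (d : WithTop ℕ∞) ≤ ∞ := by exact_mod_cast le_top
  obtain ⟨M₁, hM₁, h₁⟩ := exists_norm_quadratureError_le hK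
    (contDiffOn_energyDensityDeriv (ws := ws) (n := (d : ℕ∞)) hf)
  obtain ⟨M₂, hM₂, h₂⟩ := exists_norm_quadratureError_le hK
    ((contDiff_net (d := d) (ws := ws)).of_le hd).contDiffOn
  obtain ⟨M₃, hM₃, h₃⟩ := exists_norm_quadratureError_le hK
    ((contDiff_netDeriv (d := d) (ws := ws)).of_le hd).contDiffOn
  obtain ⟨V, hV⟩ := (hK.prod (isCompact_unitCube d)).exists_bound_of_continuousOn
    (contDiff_net (d := d) (ws := ws)).continuous.continuousOn
  obtain ⟨W, hW⟩ := (hK.prod (isCompact_unitCube d)).exists_bound_of_continuousOn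
    (contDiff_netDeriv (d := d) (ws := ws)).continuous.continuousOn
  refine ⟨M₁ + (M₂ * max W 0 + max V 0 * M₃), by positivity, fun θ hθ n hn X hX => ?_⟩
  have hn' : (0 : ℝ) < n := by exact_mod_cast hn
  have e₁ := h₁ θ hθ n hn X hX
  have e₂ := h₂ θ hθ n hn X hX
  have e₃ := h₃ θ hθ n hn X hX
  have hmean : ‖(1 / (n : ℝ)) • ∑ j, netDeriv (θ, X j)‖ ≤ max W 0 := by
    rw [norm_smul, Real.norm_of_nonneg (by positivity), one_div_mul_eq_div, div_le_iff₀ hn']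
    refine (norm_sum_le_of_le _ fun j _ => (hW (θ, X j) ⟨hθ, hX j⟩).trans
      (le_max_left W 0)).trans ?_
    simp [mul_comm]
  have hint : ‖∫ x in unitCube d, net θ x‖ ≤ max V 0 := by
    refine (norm_setIntegral_le_of_norm_le_const (isCompact_unitCube d).measure_lt_top
      fun x hx => (hV (θ, x) ⟨hθ, hx⟩).trans (le_max_left V 0)).trans ?_
    rw [volume_real_unitCube, mul_one]
  -- The squared-mean penalty contributes a difference of products, split as `ab - AB = (a - A)b +
  -- A(b - B)`.
  have hdiff : fderiv ℝ (fun ϑ : Weights d ws => empiricalFunctional X f (net ϑ)) θ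
      - fderiv ℝ (poissonLoss f) θ
      = quadratureError X (fun x => energyDensityDeriv f (θ, x))
        + (quadratureError X (fun x => net θ x) • ((1 / (n : ℝ)) • ∑ j, netDeriv (θ, X j))
          + (∫ x in unitCube d, net θ x) • quadratureError X fun x => netDeriv (θ, x)) := by
    rw [(hasFDerivAt_empiricalFunctional X f θ).fderiv,
      (hasFDerivAt_poissonLoss (n := (d : ℕ∞)) hf θ).fderiv]
    simp only [quadratureError, smul_eq_mul]
    module
  rw [gradEstimator, gradient, gradient, ← map_sub, LinearIsometryEquiv.norm_map, hdiff]
  have h0 := starDiscrepancy_nonneg X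
  calc _ ≤ _ + (_ + _) := (norm_add_le _ _).trans
        (add_le_add le_rfl (norm_add_le _ _))
    _ ≤ M₁ * starDiscrepancy X + ((M₂ * starDiscrepancy X) * max W 0
        + max V 0 * (M₃ * starDiscrepancy X)) := by
      rw [norm_smul, norm_smul (∫ x in unitCube d, net θ x)]
      gcongr
    _ = _ := by ring

end Gradients

/-! ### Inexact gradient descent under strong convexity. -/

section Optimization

variable {E : Type*} [NormedAddCommGroup E] [InnerProductSpace ℝ E] [CompleteSpace E]
  {K : Set E} {L : E → ℝ} {L₀ c : ℝ}

theorem le_add_inner_add_of_lipschitz_gradient (hK : Convex ℝ K) (hdiff : Differentiable ℝ L)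
    (hL : ∀ θ ∈ K, ∀ θ' ∈ K, ‖gradient L θ - gradient L θ'‖ ≤ L₀ * ‖θ - θ'‖)
    {x y : E} (hx : x ∈ K) (hy : y ∈ K) :
    L y ≤ L x + inner ℝ (gradient L x) (y - x) + L₀ / 2 * ‖y - x‖ ^ 2 := by
  set v := y - x with hv
  -- `L` along the segment minus the linear and quadratic terms of the claimed bound. The Lipschitz
  -- gradient makes `φ` antitone, and `φ 1 ≤ φ 0` is the claim.
  let φ : ℝ → ℝ := fun t =>
    L (x + t • v) - t * inner ℝ (gradient L x) v - L₀ / 2 * ‖v‖ ^ 2 * t ^ 2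
  have hφ : ∀ t, HasDerivAt φ (inner ℝ (gradient L (x + t • v)) v - inner ℝ (gradient L x) v
      - L₀ * ‖v‖ ^ 2 * t) t := by
    intro t
    have h₁ : HasDerivAt (fun t : ℝ => x + t • v) v t := by
      simpa using ((hasDerivAt_id t).smul_const v).const_add x
    have h₂ := (hdiff (x + t • v)).hasFDerivAt.comp_hasDerivAt t h₁
    rw [← inner_gradient_left] at h₂
    have h₃ := (hasDerivAt_id t).mul_const (inner ℝ (gradient L x) v)
    have h₄ := ((hasDerivAt_id t).pow 2).const_mul (L₀ / 2 * ‖v‖ ^ 2)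
    refine ((h₂.sub h₃).sub h₄).congr_deriv ?_
    simp only [id_eq]
    push_cast
    ring
  have hanti : AntitoneOn φ (Set.Icc 0 1) := by
    refine antitoneOn_of_deriv_nonpos (convex_Icc 0 1)
      (fun t _ => (hφ t).continuousAt.continuousWithinAt)
      (fun t _ => (hφ t).differentiableAt.differentiableWithinAt) fun t ht => ?_
    rw [interior_Icc] at ht
    rw [(hφ t).deriv, ← inner_sub_left]
    have hmem : x + t • v ∈ K := hK.add_smul_sub_mem hx hy (Set.Ioo_subset_Icc_self ht)
    have h₁ := hL _ hmem x hx
    rw [add_sub_cancel_left, norm_smul, Real.norm_of_nonneg ht.1.le] at h₁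
    have h₂ := real_inner_le_norm (gradient L (x + t • v) - gradient L x) v
    have h₃ := mul_le_mul_of_nonneg_right h₁ (norm_nonneg v)
    nlinarith
  have h := hanti (Set.left_mem_Icc.2 zero_le_one) (Set.right_mem_Icc.2 zero_le_one) zero_le_one
  simp only [φ, zero_smul, one_smul, add_zero, hv, add_sub_cancel] at h
  rw [← hv] at h
  linarith

omit [CompleteSpace E] in
-- Strong convexity at the midpoint, applied towards both endpoints: the linear terms cancel in the
-- sum, and minimality forces the quadratic term to vanish.
theorem eq_of_strongly_convex_of_isMin (hK : Convex ℝ K) (hc : 0 < c) {g : E → E}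
    (hconv : ∀ θ ∈ K, ∀ θ' ∈ K,
      L θ + inner ℝ (g θ) (θ' - θ) + c / 2 * ‖θ' - θ‖ ^ 2 ≤ L θ')
    {x y : E} (hx : x ∈ K) (hy : y ∈ K) (hmin : ∀ θ ∈ K, L y ≤ L θ) (hxy : L x = L y) :
    x = y := by
  have hm : midpoint ℝ x y ∈ K := hK.midpoint_mem hx hy
  have h₁ := hconv _ hm x hx
  have h₂ := hconv _ hm y hy
  have h₃ := hmin _ hm
  have e₁ : x - midpoint ℝ x y = (1 / 2 : ℝ) • (x - y) := by
    rw [left_sub_midpoint, invOf_eq_inv, one_div]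
  have e₂ : y - midpoint ℝ x y = -((1 / 2 : ℝ) • (x - y)) := by
    rw [right_sub_midpoint, invOf_eq_inv, one_div, ← smul_neg, neg_sub]
  rw [e₁, norm_smul] at h₁
  rw [e₂, inner_neg_right, norm_neg, norm_smul] at h₂
  have h₄ : ‖(1 / 2 : ℝ)‖ = 1 / 2 := by norm_num
  rw [h₄] at h₁ h₂
  have h₅ : c * ‖x - y‖ ^ 2 ≤ 0 := by nlinarith
  have h₆ : ‖x - y‖ ^ 2 ≤ 0 := by
    by_contra! h
    exact absurd h₅ (not_le.2 (mul_pos hc h))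
  rw [← sub_eq_zero, ← norm_eq_zero]
  exact pow_eq_zero_iff two_ne_zero |>.1 (le_antisymm h₆ (sq_nonneg _))

omit [CompleteSpace E] in
-- The Polyak–Łojasiewicz inequality: maximize `‖g x‖ s - c/2 s ^ 2` over `s = ‖y - x‖`.
theorem two_mul_sub_le_norm_sq_of_strongly_convex (hc : 0 < c) {g : E → E} {x y : E}
    (hconv : L x + inner ℝ (g x) (y - x) + c / 2 * ‖y - x‖ ^ 2 ≤ L y) :
    2 * c * (L x - L y) ≤ ‖g x‖ ^ 2 := by
  have h₁ := neg_le_of_abs_le (abs_real_inner_le_norm (g x) (y - x))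
  have h₂ : L x - L y ≤ ‖g x‖ * ‖y - x‖ - c / 2 * ‖y - x‖ ^ 2 := by linarith
  have h₃ := mul_le_mul_of_nonneg_left h₂ (by positivity : 0 ≤ 2 * c)
  nlinarith [sq_nonneg (‖g x‖ - c * ‖y - x‖)]

theorem inexact_gradient_step_le (hK : Convex ℝ K) (hdiff : Differentiable ℝ L)
    (hL : ∀ θ ∈ K, ∀ θ' ∈ K, ‖gradient L θ - gradient L θ'‖ ≤ L₀ * ‖θ - θ'‖) (hL₀ : 0 < L₀)
    {α : ℝ} (hα : 0 < α) (hαL : α < 2 / L₀) {x G : E} (hx : x ∈ K) (hx' : x - α • G ∈ K) :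
    L (x - α • G) ≤ L x - α * (1 - L₀ * α / 2) / 2 * ‖gradient L x‖ ^ 2
      + (α ^ 2 / (2 * (α * (1 - L₀ * α / 2))) + L₀ * α ^ 2 / 2) * ‖G - gradient L x‖ ^ 2 := by
  have hα' : L₀ * α < 2 := by rwa [lt_div_iff₀ hL₀, mul_comm] at hαL
  set a := α * (1 - L₀ * α / 2) with ha
  have ha0 : 0 < a := mul_pos hα (by linarith)
  have h := le_add_inner_add_of_lipschitz_gradient hK hdiff hL hx hx'
  set g := gradient L x
  set e := G - g
  have hG : G = g + e := by simp [e]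
  have hsub : x - α • G - x = -(α • (g + e)) := by rw [hG]; abel
  rw [hsub, norm_neg, norm_smul, mul_pow, norm_add_sq_real, inner_neg_right, inner_smul_right,
    inner_add_right, real_inner_self_eq_norm_sq, Real.norm_of_nonneg hα.le] at h
  have hin : -(α * (1 - L₀ * α) * inner ℝ g e) ≤ α * (‖g‖ * ‖e‖) := by
    have h₁ := abs_real_inner_le_norm g e
    have h₂ : |1 - L₀ * α| ≤ 1 := by
      rw [abs_le]
      constructor <;> nlinarith [mul_pos hL₀ hα]
    calc _ ≤ |α * (1 - L₀ * α) * inner ℝ g e| := neg_le_abs _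
      _ = α * (|1 - L₀ * α| * |inner ℝ g e|) := by
        rw [abs_mul, abs_mul, abs_of_pos hα, mul_assoc]
      _ ≤ α * (1 * (‖g‖ * ‖e‖)) := by gcongr
      _ = _ := by ring
  -- Young's inequality, weighted so that the cross term uses up only half of the decrease `a * ‖g‖
  -- ^ 2`.
  have hsq : α * (‖g‖ * ‖e‖) ≤ a / 2 * ‖g‖ ^ 2 + α ^ 2 / (2 * a) * ‖e‖ ^ 2 := by
    have h₁ : a / 2 * ‖g‖ ^ 2 + α ^ 2 / (2 * a) * ‖e‖ ^ 2 - α * (‖g‖ * ‖e‖)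
        = a / 2 * (‖g‖ - α / a * ‖e‖) ^ 2 := by
      field_simp
      ring
    have h₂ : 0 ≤ a / 2 * (‖g‖ - α / a * ‖e‖) ^ 2 := by positivity
    linarith
  have hexp : L x + -(α * (‖g‖ ^ 2 + inner ℝ g e))
      + L₀ / 2 * (α ^ 2 * (‖g‖ ^ 2 + 2 * inner ℝ g e + ‖e‖ ^ 2))
      = L x - a * ‖g‖ ^ 2 + -(α * (1 - L₀ * α) * inner ℝ g e) + L₀ * α ^ 2 / 2 * ‖e‖ ^ 2 := by
    rw [ha]
    ring
  rw [hexp] at h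
  linarith

theorem exists_inexact_gradient_descent_le (hK : Convex ℝ K) (hdiff : Differentiable ℝ L)
    (hc : 0 < c) (hcL : c < L₀)
    (hL : ∀ θ ∈ K, ∀ θ' ∈ K, ‖gradient L θ - gradient L θ'‖ ≤ L₀ * ‖θ - θ'‖)
    (hconv : ∀ θ ∈ K, ∀ θ' ∈ K,
      L θ + inner ℝ (gradient L θ) (θ' - θ) + c / 2 * ‖θ' - θ‖ ^ 2 ≤ L θ')
    {α : ℝ} (hα : 0 < α) (hαL : α < 2 / L₀) {θs : E} (hθs : θs ∈ K) :
    ∃ q T : ℝ, 0 ≤ q ∧ q < 1 ∧ 0 ≤ T ∧ ∀ ε : ℝ, 0 ≤ ε → ∀ θ G : ℕ → E,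
      (∀ k, θ (k + 1) = θ k - α • G k) → (∀ k, θ k ∈ K) →
      (∀ k, ‖G k - gradient L (θ k)‖ ≤ ε) →
        ∀ k, L (θ k) - L θs ≤ q ^ k * (L (θ 0) - L θs) + T * ε ^ 2 := by
  have hL₀ : 0 < L₀ := hc.trans hcL
  have hα' : L₀ * α < 2 := by rwa [lt_div_iff₀ hL₀, mul_comm] at hαL
  set a := α * (1 - L₀ * α / 2) with ha
  have ha0 : 0 < a := mul_pos hα (by linarith)
  -- `u (1 - u/2)` with `u = L₀ α` is at most `1/2`; with `c < L₀` this makes `1 - a * c` a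
  -- contraction factor.
  have haL : 2 * (a * L₀) ≤ 1 := by
    rw [ha]
    nlinarith [sq_nonneg (L₀ * α - 1)]
  have hac : a * c < 1 := by nlinarith
  set S := α ^ 2 / (2 * a) + L₀ * α ^ 2 / 2 with hS
  have hS0 : 0 ≤ S := by positivity
  have hac0 : 0 < a * c := mul_pos ha0 hc
  -- `S / (a * c)` is the fixed point of `T ↦ (1 - a * c) * T + S`.
  refine ⟨1 - a * c, S / (a * c), by linarith, by linarith, by positivity,
    fun ε hε θ G hstep hmem herr k => ?_⟩
  induction k with
  | zero =>
    have : 0 ≤ S / (a * c) * ε ^ 2 := by positivity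
    simpa using this
  | succ k ih =>
    have h₁ := inexact_gradient_step_le hK hdiff hL hL₀ hα hαL (hmem k)
      (G := G k) (hstep k ▸ hmem (k + 1))
    rw [← hstep k, ← ha, ← hS] at h₁
    have h₂ := two_mul_sub_le_norm_sq_of_strongly_convex (g := gradient L) hc
      (hconv _ (hmem k) _ hθs)
    have h₃ : S * ‖G k - gradient L (θ k)‖ ^ 2 ≤ S * ε ^ 2 := by
      have := herr k
      gcongr
    have h₄ := mul_le_mul_of_nonneg_left h₂ (by positivity : 0 ≤ a / 2)
    have h₅ := mul_le_mul_of_nonneg_left ih (by linarith : 0 ≤ 1 - a * c)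
    have h₆ : (1 - a * c) * ((1 - a * c) ^ k * (L (θ 0) - L θs) + S / (a * c) * ε ^ 2) + S * ε ^ 2
        = (1 - a * c) ^ (k + 1) * (L (θ 0) - L θs) + S / (a * c) * ε ^ 2 := by
      field_simp
      ring
    linarith

end Optimization

/-! ### The rate, limits superior and compactness. -/

section Rate

theorem inv_mul_log_pow_le_factorial (d : ℕ) {n : ℕ} (hn : 0 < n) :
    (n : ℝ)⁻¹ * Real.log n ^ d ≤ d.factorial := by
  have hn' : (0 : ℝ) < n := by exact_mod_cast hn
  have h := Real.pow_div_factorial_le_exp (Real.log n) (Real.log_natCast_nonneg n) d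
  rw [Real.exp_log hn', div_le_iff₀ (by positivity)] at h
  rwa [inv_mul_le_iff₀ hn']

/-- In `EReal` the comparison of limsups has no boundedness side conditions. -/
theorem limsup_coe_ereal_le_of_tendsto {u v : ℕ → ℝ} {l : ℝ} (huv : ∀ k, u k ≤ v k)
    (hv : Tendsto v atTop (𝓝 l)) : limsup (fun k => (u k : EReal)) atTop ≤ (l : EReal) := by
  have h : Tendsto (fun k => (v k : EReal)) atTop (𝓝 (l : EReal)) :=
    (continuous_coe_real_ereal.tendsto l).comp hv
  rw [← h.limsup_eq]
  exact limsup_le_limsup (Eventually.of_forall fun k => EReal.coe_le_coe_iff.2 (huv k))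

theorem isCompact_of_isClosed_of_subset_paramBox {d : ℕ} {ws : List ℕ} {B : ℝ}
    {K : Set (Weights d ws)} (hKΘ : K ⊆ paramBox d ws B) (hK : IsClosed K) : IsCompact K := by
  have h : IsCompact (WithLp.toLp 2 '' Set.univ.pi fun _ : WeightIndex d ws => Set.Icc (-B) B) :=
    (isCompact_univ_pi fun _ => isCompact_Icc).image
      (PiLp.continuous_toLp 2 (fun _ : WeightIndex d ws => ℝ))
  refine h.of_isClosed_subset hK fun θ hθ => ⟨WithLp.ofLp θ, fun p _ => ?_, rfl⟩
  exact abs_le.1 (hKΘ hθ p)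

end Rate

end DeepRitz

theorem theorem3p6
    (d : ℕ) (hd : 0 < d)
    -- the network: hidden widths `ws`, weight bound `B`
    (ws : List ℕ) (B : ℝ) (hB : 0 < B)
    -- the right-hand side of the Poisson equation
    (f : EuclideanSpace ℝ (Fin d) → ℝ)
    (hf : ContDiffOn ℝ d f (DeepRitz.unitCube d))
    (hf0 : ∫ x in DeepRitz.unitCube d, f x = 0)
    -- the region of strong convexity: the whole parameter box, or a closed convex part of it
    (K : Set (DeepRitz.Weights d ws)) (hKΘ : K ⊆ DeepRitz.paramBox d ws B)
    (hKne : K.Nonempty) (hKclosed : IsClosed K) (hKconvex : Convex ℝ K)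
    (L₀ c : ℝ) (hc : 0 < c) (hcL : c < L₀)
    -- `L₀` is a Lipschitz constant of the gradient of the loss
    (hL : ∀ θ ∈ K, ∀ θ' ∈ K,
      ‖gradient (DeepRitz.poissonLoss f) θ - gradient (DeepRitz.poissonLoss f) θ'‖
        ≤ L₀ * ‖θ - θ'‖)
    -- strong convexity of the loss
    (hconv : ∀ θ ∈ K, ∀ θ' ∈ K,
      DeepRitz.poissonLoss f θ
          + inner ℝ (gradient (DeepRitz.poissonLoss f) θ) (θ' - θ)
          + c / 2 * ‖θ' - θ‖ ^ 2
        ≤ DeepRitz.poissonLoss f θ')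
    (α : ℝ) (hα : 0 < α) (hαL : α < 2 / L₀)
    (P : ℕ → EuclideanSpace ℝ (Fin d)) (hP : DeepRitz.HasLowDiscrepancyBlocks P) :
    ∃ θs ∈ K,
      (∀ θ ∈ K, DeepRitz.poissonLoss f θs ≤ DeepRitz.poissonLoss f θ) ∧
      (∀ θ ∈ K, DeepRitz.poissonLoss f θ = DeepRitz.poissonLoss f θs → θ = θs) ∧
      ∃ C : ℝ, ∀ τ : ℕ, 1 ≤ τ → ∀ n : ℕ, n = 2 ^ τ →
        ∀ θ : ℕ → DeepRitz.Weights d ws,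
          DeepRitz.IsDescent f P α n θ → (∀ k, θ k ∈ K) →
            limsup (fun k : ℕ =>
                ((DeepRitz.poissonLoss f (θ k) - DeepRitz.poissonLoss f θs : ℝ) : EReal)) atTop
              ≤ ((C * ((n : ℝ)⁻¹ * Real.log n ^ d) : ℝ) : EReal) ∧
            ∀ ℓ : ℝ,
              Tendsto (fun k : ℕ =>
                DeepRitz.poissonLoss f (θ k) - DeepRitz.poissonLoss f θs) atTop (𝓝 ℓ) →
              |ℓ| ≤ C * ((n : ℝ)⁻¹ * Real.log n ^ d) := by
  have hK := DeepRitz.isCompact_of_isClosed_of_subset_paramBox hKΘ hKclosed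
  have hdiff : Differentiable ℝ (DeepRitz.poissonLoss (ws := ws) f) := fun θ =>
    (DeepRitz.hasFDerivAt_poissonLoss (n := (d : ℕ∞)) hf θ).differentiableAt
  obtain ⟨θs, hθs, hmin⟩ := hK.exists_isMinOn hKne hdiff.continuous.continuousOn
  have hmin' : ∀ θ ∈ K, DeepRitz.poissonLoss f θs ≤ DeepRitz.poissonLoss f θ :=
    fun θ hθ => hmin hθ
  refine ⟨θs, hθs, hmin', fun θ hθ h =>
    DeepRitz.eq_of_strongly_convex_of_isMin hKconvex hc hconv hθ hθs hmin' h, ?_⟩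
  obtain ⟨hPmem, C₀, hC₀⟩ := hP
  obtain ⟨M, hM, herr⟩ := DeepRitz.exists_norm_gradEstimator_sub_gradient_le hf hK
  obtain ⟨q, T, hq, hq1, hT, hdesc⟩ := DeepRitz.exists_inexact_gradient_descent_le hKconvex hdiff
    hc hcL hL hconv hα hαL hθs
  refine ⟨T * (M * |C₀|) ^ 2 * d.factorial, fun τ hτ n hn θ hθ hθK => ?_⟩
  have hnpos : 0 < n := hn ▸ pow_pos two_pos τ
  set r := (n : ℝ)⁻¹ * Real.log n ^ d with hr
  have hr0 : 0 ≤ r := mul_nonneg (by positivity) (pow_nonneg (Real.log_natCast_nonneg n) d)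
  have hrd : r ≤ d.factorial := DeepRitz.inv_mul_log_pow_le_factorial d hnpos
  -- The absolute value makes the error level nonnegative, as the sign of `C₀` is unknown.
  have hbound := hdesc (M * (|C₀| * r)) (by positivity) θ
    (fun k => DeepRitz.gradEstimator f (DeepRitz.block P n k) (θ k)) hθ hθK fun k => by
      refine (herr _ (hθK k) n hnpos _ fun j => hPmem _).trans ?_
      gcongr
      exact (hC₀ τ hτ n hn k).trans (mul_le_mul_of_nonneg_right (le_abs_self C₀) hr0)
  have hlim : Tendsto (fun k => q ^ k * (DeepRitz.poissonLoss f (θ 0) - DeepRitz.poissonLoss f θs)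
      + T * (M * (|C₀| * r)) ^ 2) atTop (𝓝 (T * (M * (|C₀| * r)) ^ 2)) := by
    simpa using ((tendsto_pow_atTop_nhds_zero_of_lt_one hq hq1).mul_const
      (DeepRitz.poissonLoss f (θ 0) - DeepRitz.poissonLoss f θs)).add_const
        (T * (M * (|C₀| * r)) ^ 2)
  -- One of the two factors `r` is given up through `r ≤ d!`.
  have hrate : T * (M * (|C₀| * r)) ^ 2 ≤ T * (M * |C₀|) ^ 2 * d.factorial * r := by
    calc T * (M * (|C₀| * r)) ^ 2 = T * (M * |C₀|) ^ 2 * r * r := by ring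
      _ ≤ _ := by gcongr
  refine ⟨(DeepRitz.limsup_coe_ereal_le_of_tendsto hbound hlim).trans
    (EReal.coe_le_coe_iff.2 hrate), fun ℓ hℓ => ?_⟩
  have hℓ0 : 0 ≤ ℓ := ge_of_tendsto' hℓ fun k => sub_nonneg.2 (hmin' _ (hθK k))
  rw [abs_of_nonneg hℓ0]
  exact (le_of_tendsto_of_tendsto' hℓ hlim hbound).trans hrate
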